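/- Let $\mathcal R$ be a commutative integral domain (with $1\neq 0$) which is $2$-torsion free (i.e. $2r=0$ implies $r=0$), let $n\ge 2$, and let $\mathcal T=\mathcal T_n(\mathcal R)$ be the $\mathcal R$-algebra of all $n\times n$ upper triangular matrices over $\mathcal R$, with center $\mathcal Z(\mathcal T)$. Let $\mathfrak q\colon \mathcal T\times\mathcal T\to\mathcal T$ be an $\mathcal R$-bilinear map whose trace $\mathfrak T_{\mathfrak q}(a)=\mathfrak q(a,a)$ is centralizing, i.e. $[\mathfrak T_{\mathfrak q}(a),a]=\mathfrak T_{\mathfrak q}(a)a-a\mathfrak T_{\mathfrak q}(a)\in\mathcal Z(\mathcal T)$ for all $a\in\mathcal T$. Then $\mathfrak T_{\mathfrak q}$ is proper: there exist $z\in\mathcal Z(\mathcal T)$, an $\mathcal R$-linear map $\mu\colon\mathcal T\to\mathcal Z(\mathcal T)$ and an $\mathcal R$-bilinear map $\nu\colon\mathcal T\times\mathcal T\to\mathcal Z(\mathcal T)$ such that $$\mathfrak T_{\mathfrak q}(a)=z a^2+\mu(a)\,a+\nu(a,a)\qquad\text{for all } a\in\mathcal T.$$ -/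

import Mathlib

/-- The `R`-algebra of all `n × n` upper triangular matrices over `R`,
i.e. matrices whose entries strictly below the diagonal vanish. -/
def upperTriangular (n : ℕ) (R : Type*) [CommRing R] :
    Subalgebra R (Matrix (Fin n) (Fin n) R) :=
  Matrix.blockTriangularSubalgebra R R (id : Fin n → Fin n)

/-- A matrix lies in `upperTriangular n R` iff its entries below the diagonal vanish. -/
theorem mem_upperTriangular_iff {n : ℕ} {R : Type*} [CommRing R]
    {M : Matrix (Fin n) (Fin n) R} :
    M ∈ upperTriangular n R ↔ ∀ i j : Fin n, j < i → M i j = 0 :=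
  ⟨fun h _ _ hij => h hij, fun h i j hij => h i j hij⟩

section

variable {R A : Type*} [CommRing R] [Ring A] [Algebra R A]

/-- The trace `a ↦ q(a, a)` of an `R`-bilinear map `q : A × A → A`. -/
def bilinTrace (q : A →ₗ[R] A →ₗ[R] A) (a : A) : A := q a a

/-- A map `f : A → A` is centralizing if `[f(a), a] = f(a) a - a f(a)` is central for every `a`. -/
def IsCentralizing (R : Type*) {A : Type*} [CommRing R] [Ring A] [Algebra R A]
    (f : A → A) : Prop :=
  ∀ a : A, f a * a - a * f a ∈ Subalgebra.center R A

/-- A map `f : A → A` has the proper form (as the trace of a bilinear map) if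
`f(a) = z a² + μ(a) a + ν(a)` with `z` central, `μ` an `R`-linear map into the center and
`ν` the trace of an `R`-bilinear map into the center. -/
def IsProperQuadratic (R : Type*) {A : Type*} [CommRing R] [Ring A] [Algebra R A]
    (f : A → A) : Prop :=
  ∃ (z : Subalgebra.center R A) (μ : A →ₗ[R] Subalgebra.center R A)
    (ν : A →ₗ[R] A →ₗ[R] Subalgebra.center R A),
    ∀ a : A, f a = (z : A) * a ^ 2 + (μ a : A) * a + (ν a a : A)

end

/-! A central commutator in the triangular algebra is zero, so the trace commutes: [q(a,a), a] = 0.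
Write B(a,b) = q(a,b) + q(b,a). Polarizing at a diagonal matrix t in the direction of a matrix unit
e_ij shows that the diagonal entries of q(t,t) differ by (t_i - t_j) times a linear form.
Compatibility of these forms (`exists_eq_of_three_term_relation`) yields z and a first μ;
subtracting them makes q(t,t) scalar. The full linearization at t, b, e_kl then makes the diagonal
entries of B(t,b) differ by c(b)(t_k - t_l), with one c(b) for all pairs (`sub_eq_of_dvd`): a second
μ. Once B(t,b) is scalar for all diagonal t, the whole remaining trace is scalar (`isScalar_trace`)
and serves as ν. -/

/-! ### Cancelling a nonzero linear form over a domain -/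

section Functionals

variable {R M : Type*} [CommRing R] [IsDomain R] [AddCommGroup M] [Module R M]

/-- If a product of two linear functionals vanishes pointwise, one of them is zero. -/
theorem linearMap_eq_zero_of_mul_eq_zero {f g : M →ₗ[R] R} {y : M} (hy : f y ≠ 0)
    (h : ∀ x, g x * f x = 0) (x : M) : g x = 0 := by
  have key : ∀ x, f x ≠ 0 → g x = 0 := fun x hx => (mul_eq_zero.1 (h x)).resolve_right hx
  by_cases hx : f x = 0
  · have h1 := key (x + y) (by simpa [hx] using hy)
    simpa [key y hy] using h1
  · exact key x hx

/-- If the product of a quadratic form with a nonzero linear functional vanishes pointwise, the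
quadratic form vanishes. -/
theorem bilin_self_eq_zero_of_mul_eq_zero (h2 : ∀ r : R, 2 * r = 0 → r = 0)
    {f : M →ₗ[R] R} {g : M →ₗ[R] M →ₗ[R] R} {y : M} (hy : f y ≠ 0)
    (h : ∀ x, g x x * f x = 0) (x : M) : g x x = 0 := by
  have key : ∀ x, f x ≠ 0 → g x x = 0 := fun x hx => (mul_eq_zero.1 (h x)).resolve_right hx
  by_cases hx : f x = 0
  · have h1 := key (x + y) (by simpa [hx] using hy)
    -- On the kernel of f both x + y and x - y avoid the kernel; the parallelogram law then gives 2
    -- g(x,x) = 0.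
    have h3 := key (x - y) (by simpa [hx] using hy)
    have h4 := key y hy
    simp only [map_add, map_sub, LinearMap.add_apply, LinearMap.sub_apply] at h1 h3
    exact h2 _ (by linear_combination h1 + h3 - 2 * h4)
  · exact key x hx

end Functionals

/-! ### Compatible families of divided differences -/

section Families

variable {R ι : Type*} [CommRing R] [DecidableEq ι]

/-- A symmetric family of linear forms `l i j` satisfying the three-term relation
`(tᵢ - tⱼ) lᵢⱼ + (tⱼ - tₖ) lⱼₖ = (tᵢ - tₖ) lᵢₖ` has the form `z (tᵢ + tⱼ) + μ(t)`. -/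
theorem exists_eq_of_three_term_relation [Fintype ι] {l : ι → ι → (ι → R) →ₗ[R] R}
    (hs : ∀ i j, i ≠ j → l i j = l j i)
    (h3 : ∀ i j k t, i ≠ j → j ≠ k → i ≠ k →
      (t i - t j) * l i j t + (t j - t k) * l j k t = (t i - t k) * l i k t) :
    ∃ (z : R) (μ : (ι → R) →ₗ[R] R), ∀ i j t, i ≠ j → l i j t = z * (t i + t j) + μ t := by
  by_cases hc : ∃ i j k : ι, i ≠ j ∧ j ≠ k ∧ i ≠ k
  swap
  -- With at most two indices the relation is vacuous: z = 0 and the only form serves as μ.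
  · by_cases hp : ∃ i j : ι, i ≠ j
    · obtain ⟨a, b, hab⟩ := hp
      refine ⟨0, l a b, fun i j t hij => ?_⟩
      have : (i = a ∧ j = b) ∨ (i = b ∧ j = a) := by
        push Not at hc
        have := hc a b i hab
        have := hc a b j hab
        grind
      rcases this with ⟨rfl, rfl⟩ | ⟨rfl, rfl⟩
      · simp
      · simp [hs _ _ hij]
    · push Not at hp
      exact ⟨0, 0, fun i j t hij => absurd (hp i j) hij⟩
  obtain ⟨a, b, d, hab, hbd, had⟩ := hc
  set E : ι → ι → R := fun m => Pi.single m 1 with hE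
  have hEs : ∀ m, E m m = 1 := fun m => by simp [hE]
  have hEn : ∀ m k, k ≠ m → E m k = 0 := fun m k h => by simp [hE, h]
  have r1 : ∀ i j k, i ≠ j → j ≠ k → i ≠ k → l i j (E i) = l i k (E i) := by
    intro i j k hij hjk hik
    have := h3 i j k (E i) hij hjk hik
    simpa [hEs, hEn i j hij.symm, hEn i k hik.symm] using this
  have r2 : ∀ i j k m, i ≠ j → j ≠ k → i ≠ k → m ≠ i → m ≠ j → m ≠ k →
      l i j (E m) = l i k (E m) := by
    intro i j k m hij hjk hik hi hj hk
    have := h3 i j k (E i + E m) hij hjk hik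
    simpa [hEs, hEn i j hij.symm, hEn i k hik.symm, hEn m i hi.symm, hEn m j hj.symm,
      hEn m k hk.symm, r1 i j k hij hjk hik] using this
  -- At `E i + E j` the factor t_i - t_j vanishes, so the form `l i j` drops out.
  have r3 : ∀ i j k, i ≠ j → j ≠ k → i ≠ k →
      l i k (E i) + l i k (E j) = l j k (E i) + l j k (E j) := by
    intro i j k hij hjk hik
    have := h3 i j k (E i + E j) hij hjk hik
    simpa [hEs, hEn i j hij.symm, hEn i k hik.symm, hEn j i hij, hEn j k hjk.symm, eq_comm]
      using this
  have exα : ∀ i, ∃ α, ∀ j, i ≠ j → l i j (E i) = α := by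
    intro i
    obtain ⟨s, hs⟩ : ∃ s, i ≠ s := by
      by_cases h : i = a
      · exact ⟨b, h ▸ hab⟩
      · exact ⟨a, h⟩
    refine ⟨l i s (E i), fun j hj => ?_⟩
    by_cases hjs : j = s
    · rw [hjs]
    · exact r1 i j s hj hjs hs
  have exβ : ∀ m, ∃ β, ∀ i j, i ≠ j → m ≠ i → m ≠ j → l i j (E m) = β := by
    intro m
    obtain ⟨u, v, huv, hmu, hmv⟩ : ∃ u v, u ≠ v ∧ m ≠ u ∧ m ≠ v := by
      by_cases h1 : m = a
      · exact ⟨b, d, hbd, h1 ▸ hab, h1 ▸ had⟩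
      · by_cases h2 : m = b
        · exact ⟨a, d, had, h1, h2 ▸ hbd⟩
        · exact ⟨a, b, hab, h1, h2⟩
    have step : ∀ i, i ≠ v → m ≠ i → l i v (E m) = l u v (E m) := by
      intro i hi hmi
      by_cases hiu : i = u
      · rw [hiu]
      · rw [hs i v hi, hs u v huv]
        exact r2 v i u m hi.symm hiu huv.symm hmv hmi hmu
    refine ⟨l u v (E m), fun i j hij hi hj => ?_⟩
    by_cases hiv : i = v
    · subst hiv
      rw [hs i j hij]
      exact step j hij.symm hj
    · rw [← step i hiv hi]
      by_cases hjv : j = v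
      · rw [hjv]
      · exact r2 i j v m hij hjv hiv hi hj hmv
  -- The coefficient of t_m in `l i j` is α_m if m is i or j, and β_m otherwise. The constant α_m -
  -- β_m becomes z, and the β_m are the coefficients of μ.
  choose α hα using exα
  choose β hβ using exβ
  have hz : ∀ i j, α i - β i = α j - β j := by
    intro i j
    by_cases hij : i = j
    · rw [hij]
    obtain ⟨k, hjk, hik⟩ : ∃ k, j ≠ k ∧ i ≠ k := by
      by_contra! h
      have ha := h a
      have hb := h b
      have hd := h d
      by_cases h1 : j = a <;> by_cases h2 : j = b <;> by_cases h3 : j = d <;> grind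
    have := r3 i j k hij hjk hik
    rw [hα i k hik, hα j k hjk, hβ i j k hjk hij hik, hβ j i k hik (Ne.symm hij) hjk] at this
    linear_combination this
  refine ⟨α a - β a, ∑ m, β m • (LinearMap.proj m : (ι → R) →ₗ[R] R), fun i j t hij => ?_⟩
  have hL : l i j = (α a - β a) • ((LinearMap.proj i : (ι → R) →ₗ[R] R) + LinearMap.proj j)
      + ∑ m, β m • (LinearMap.proj m : (ι → R) →ₗ[R] R) := by
    refine LinearMap.pi_ext' fun m => LinearMap.ext_ring ?_
    have hsum : (∑ k, β k • (LinearMap.proj k : (ι → R) →ₗ[R] R)) (E m) = β m := by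
      rw [LinearMap.sum_apply, Finset.sum_eq_single m]
      · simp [hEs]
      · intro k _ hk
        simp [hEn m k hk]
      · simp
    change l i j (E m) = (α a - β a) * (E m i + E m j)
      + (∑ k, β k • (LinearMap.proj k : (ι → R) →ₗ[R] R)) (E m)
    rw [hsum]
    by_cases hmi : m = i
    · subst hmi
      rw [hα m j hij, hEs, hEn m j hij.symm, hz a m]
      ring
    by_cases hmj : m = j
    · subst hmj
      rw [hs i m hij, hα m i hij.symm, hEs, hEn m i hij, hz a m]
      ring
    · rw [hβ m i j hij hmi hmj, hEn m i (Ne.symm hmi), hEn m j (Ne.symm hmj)]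
      ring
  rw [hL]
  simp [mul_add]

/-- If all differences `pᵢ - pⱼ` are divisible by `tᵢ - tⱼ` with linear quotient, the quotients
are of the form `z (tᵢ + tⱼ) + μ(t)`. -/
theorem exists_sub_eq_of_dvd [IsDomain R] [Fintype ι] {p : ι → (ι → R) → R}
    (h : ∀ i j, ∃ l : (ι → R) →ₗ[R] R, ∀ t, p i t - p j t = (t i - t j) * l t) :
    ∃ (z : R) (μ : (ι → R) →ₗ[R] R), ∀ i j t,
      p i t - p j t = (t i - t j) * (z * (t i + t j) + μ t) := by
  choose l hl using h
  obtain ⟨z, μ, hzμ⟩ := exists_eq_of_three_term_relation (l := l) (by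
      intro i j hij
      refine LinearMap.ext fun t => sub_eq_zero.1 ?_
      refine linearMap_eq_zero_of_mul_eq_zero (g := l i j - l j i)
        (f := (LinearMap.proj i : (ι → R) →ₗ[R] R) - LinearMap.proj j) (y := Pi.single i 1) (by simp [hij.symm])
        (fun t => ?_) t
      simp only [LinearMap.sub_apply, LinearMap.proj_apply]
      linear_combination -hl i j t - hl j i t) (by
      intro i j k t _ _ _
      linear_combination hl i k t - hl i j t - hl j k t)
  refine ⟨z, μ, fun i j t => ?_⟩
  by_cases hij : i = j
  · simp [hij]
  · rw [hl, hzμ i j t hij]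

/-- If all differences `dᵢ - dⱼ` are scalar multiples of `tᵢ - tⱼ`, the scalar is the same for
all pairs. -/
theorem sub_eq_of_dvd {d : ι → (ι → R) → R}
    (h : ∀ i j, ∃ c : R, ∀ t, d i t - d j t = c * (t i - t j)) {a b : ι} (hab : a ≠ b)
    (i j : ι) (t : ι → R) :
    d i t - d j t = (d a (Pi.single a 1) - d b (Pi.single a 1)) * (t i - t j) := by
  choose c hc using h
  have hs : ∀ i j, i ≠ j → c i j = c j i := by
    intro i j hij
    have h1 := hc i j (Pi.single i 1)
    have h2 := hc j i (Pi.single i 1)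
    simp only [Pi.single_eq_same, Pi.single_eq_of_ne hij.symm] at h1 h2
    linear_combination -h1 - h2
  have ht : ∀ i j k, i ≠ j → i ≠ k → c i j = c i k := by
    intro i j k hij hik
    have h1 := hc i j (Pi.single i 1)
    have h2 := hc j k (Pi.single i 1)
    have h3 := hc i k (Pi.single i 1)
    simp only [Pi.single_eq_same, Pi.single_eq_of_ne hij.symm, Pi.single_eq_of_ne hik.symm]
      at h1 h2 h3
    linear_combination -h1 - h2 + h3
  have hcab : d a (Pi.single a 1) - d b (Pi.single a 1) = c a b := by
    simp [hc a b, hab.symm]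
  rw [hcab]
  by_cases hij : i = j
  · simp [hij]
  have : c i j = c a b := by
    by_cases hia : i = a
    · subst hia
      exact ht i j b hij hab
    · rw [ht i j a hij hia, hs i a hia, ht a i b (Ne.symm hia) hab]
  rw [hc, this]

end Families

/-! ### Linearizing the commuting identity -/

section Polarization

variable {R A : Type*} [CommRing R] [Ring A] [Algebra R A]

/-- Linearization of `[q(a,a), a] = 0` in degree `(2, 1)`. -/
theorem commutator_polarization (h2 : ∀ x : A, x + x = 0 → x = 0) {q : A →ₗ[R] A →ₗ[R] A}
    (hq : ∀ a, q a a * a - a * q a a = 0) (a b : A) :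
    ((q a b + q b a) * a - a * (q a b + q b a)) + (q a a * b - b * q a a) = 0 := by
  have h1 := hq (a + b)
  have h3 := hq (a - b)
  have ha := hq a
  have hb := hq b
  simp only [map_add, map_sub, LinearMap.add_apply, LinearMap.sub_apply] at h1 h3
  refine h2 _ ?_
  -- The difference of the identities at a + b and a - b keeps only terms odd in b; the cubic term
  -- in b is removed, and what is left is twice the claim.
  have key : ∀ x y p u v w : A,
      (v * x - x * v + (p * y - y * p)) + (v * x - x * v + (p * y - y * p)) =
        ((p + u + (v - u + w)) * (x + y) - (x + y) * (p + u + (v - u + w)))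
        - ((p - u - (v - u - w)) * (x - y) - (x - y) * (p - u - (v - u - w)))
        - (w * y - y * w) - (w * y - y * w) := by
    intro x y p u v w
    noncomm_ring
  have := key a b (q a a) (q b a) (q a b + q b a) (q b b)
  rw [add_sub_cancel_right, h1, h3, hb] at this
  simpa using this

/-- Full linearization of `[q(a,a), a] = 0`. -/
theorem commutator_polarization₃ (h2 : ∀ x : A, x + x = 0 → x = 0) {q : A →ₗ[R] A →ₗ[R] A}
    (hq : ∀ a, q a a * a - a * q a a = 0) (a b c : A) :
    ((q a b + q b a) * c - c * (q a b + q b a)) + ((q b c + q c b) * a - a * (q b c + q c b))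
      + ((q c a + q a c) * b - b * (q c a + q a c)) = 0 := by
  have h1 := commutator_polarization h2 hq (a + b) c
  have h3 := commutator_polarization h2 hq a c
  have h4 := commutator_polarization h2 hq b c
  simp only [map_add, LinearMap.add_apply] at h1
  have key : ∀ x y z aa bb ab bc ca d : A,
      (ab + d) * z - z * (ab + d) + (bc * x - x * bc) + (ca * y - y * ca) =
        ((bc + ca) * (x + y) - (x + y) * (bc + ca)
          + ((aa + d + (ab + bb)) * z - z * (aa + d + (ab + bb))))
        - (ca * x - x * ca + (aa * z - z * aa)) - (bc * y - y * bc + (bb * z - z * bb)) := by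
    intro x y z aa bb ab bc ca d
    noncomm_ring
  have e1 : q a c + q b c + (q c a + q c b) = q b c + q c b + (q a c + q c a) := by abel
  rw [e1] at h1
  rw [add_comm (q c a), key a b c (q a a) (q b b) (q a b), h1, h3, h4]
  simp

end Polarization

/-! ### Subtracting proper maps -/

section BilinearMaps

variable {R A : Type*} [CommRing R] [Ring A] [Algebra R A]

/-- The bilinear map `q(a, b) - z a b - μ(a) b`. -/
def subProper (q : A →ₗ[R] A →ₗ[R] A) (z : R) (μ : A →ₗ[R] R) : A →ₗ[R] A →ₗ[R] A :=
  q - z • LinearMap.mul R A - (LinearMap.lsmul R A) ∘ₗ μ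

theorem subProper_apply (q : A →ₗ[R] A →ₗ[R] A) (z : R) (μ : A →ₗ[R] R) (a b : A) :
    subProper q z μ a b = q a b - z • (a * b) - μ a • b := rfl

/-- Both a² and a commute with a, so the subtraction preserves the commuting identity. -/
theorem subProper_commutator {q : A →ₗ[R] A →ₗ[R] A}
    (hq : ∀ a, q a a * a - a * q a a = 0) (z : R) (μ : A →ₗ[R] R) (a : A) :
    subProper q z μ a a * a - a * subProper q z μ a a = 0 := by
  have := hq a
  simp only [subProper_apply, sub_mul, mul_sub, smul_mul_assoc, mul_smul_comm, mul_assoc]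
  rw [← this]
  abel

end BilinearMaps

/-! ### Entries and commutators of triangular matrices -/

namespace upperTriangular

variable {n : ℕ} {R : Type*} [CommRing R]

/-- The entry functional on upper triangular matrices. -/
def entry (k l : Fin n) : upperTriangular n R →ₗ[R] R :=
  Matrix.entryLinearMap R R k l ∘ₗ (upperTriangular n R).val.toLinearMap

theorem ext_entry {a b : upperTriangular n R} (h : ∀ k l, entry k l a = entry k l b) : a = b :=
  Subtype.ext (Matrix.ext h)

theorem entry_eq_zero {k l : Fin n} (h : l < k) (a : upperTriangular n R) : entry k l a = 0 :=
  mem_upperTriangular_iff.1 a.2 k l h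

theorem entry_mul (k l : Fin n) (a b : upperTriangular n R) :
    entry k l (a * b) = ∑ m, entry k m a * entry m l b :=
  Matrix.mul_apply (M := a.1) (N := b.1)

theorem entry_mul_self (k : Fin n) (a b : upperTriangular n R) :
    entry k k (a * b) = entry k k a * entry k k b := by
  rw [entry_mul, Finset.sum_eq_single k]
  · intro m _ hm
    rcases lt_or_gt_of_ne hm with h | h
    · rw [entry_eq_zero h, zero_mul]
    · rw [entry_eq_zero h b, mul_zero]
  · simp

theorem entry_algebraMap (k l : Fin n) (r : R) :
    entry k l (algebraMap R (upperTriangular n R) r) = if k = l then r else 0 := by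
  change (algebraMap R (Matrix (Fin n) (Fin n) R) r) k l = _
  rw [Matrix.algebraMap_matrix_apply]
  rfl

/-- The diagonal matrix with given diagonal, as an upper triangular matrix. -/
def ofDiag : (Fin n → R) →ₗ[R] upperTriangular n R where
  toFun t := ⟨Matrix.diagonal t,
    mem_upperTriangular_iff.2 fun _ _ h => Matrix.diagonal_apply_ne _ h.ne'⟩
  map_add' s t := Subtype.ext (Matrix.diagonal_add s t).symm
  map_smul' r t := Subtype.ext (Matrix.diagonal_smul r t)

theorem entry_ofDiag_self (t : Fin n → R) (k : Fin n) : entry k k (ofDiag t) = t k :=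
  Matrix.diagonal_apply_eq _ _

theorem entry_ofDiag_ne (t : Fin n → R) {k l : Fin n} (h : k ≠ l) :
    entry k l (ofDiag t) = 0 := Matrix.diagonal_apply_ne _ h

/-- The diagonal of an upper triangular matrix. -/
def diag : upperTriangular n R →ₗ[R] (Fin n → R) := LinearMap.pi fun k => entry k k

/-- The matrix unit `e_{kl}` with `k ≤ l`. -/
def unit {k l : Fin n} (h : k ≤ l) : upperTriangular n R :=
  ⟨Matrix.single k l 1, mem_upperTriangular_iff.2 fun i j hij => by
    rw [Matrix.single_apply, if_neg]
    rintro ⟨rfl, rfl⟩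
    exact absurd h hij.not_ge⟩

theorem entry_unit_self {k l : Fin n} (h : k ≤ l) :
    entry k l (unit h : upperTriangular n R) = 1 := Matrix.single_apply_same _ _ _

theorem entry_commutator_ofDiag (x : upperTriangular n R) (t : Fin n → R) (k l : Fin n) :
    entry k l (x * ofDiag t - ofDiag t * x) = entry k l x * (t l - t k) := by
  have h1 : entry k l (x * ofDiag t) = entry k l x * t l := Matrix.mul_diagonal t x.1 k l
  have h2 : entry k l (ofDiag t * x) = t k * entry k l x := Matrix.diagonal_mul t x.1 k l
  rw [map_sub, h1, h2]
  ring

/-- An upper triangular matrix is diagonal. -/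
def IsDiagonal (x : upperTriangular n R) : Prop := ∀ r s, r ≠ s → entry r s x = 0

theorem IsDiagonal.eq_ofDiag {x : upperTriangular n R} (hx : IsDiagonal x) :
    x = ofDiag (diag x) := by
  refine ext_entry fun k l => ?_
  by_cases h : k = l
  · subst h
    exact (entry_ofDiag_self _ _).symm
  · rw [hx k l h, entry_ofDiag_ne _ h]

theorem IsDiagonal.entry_commutator {x : upperTriangular n R} (hx : IsDiagonal x)
    (c : upperTriangular n R) (k l : Fin n) :
    entry k l (x * c - c * x) = (entry k k x - entry l l x) * entry k l c := by
  have h := entry_commutator_ofDiag c (diag x) k l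
  rw [← hx.eq_ofDiag] at h
  rw [← neg_sub, map_neg, h]
  change -(entry k l c * (entry l l x - entry k k x)) = _
  ring

/-- An upper triangular matrix is scalar. -/
def IsScalar (x : upperTriangular n R) : Prop :=
  IsDiagonal x ∧ ∀ i j, entry i i x = entry j j x

theorem IsScalar.eq_algebraMap {x : upperTriangular n R} (hx : IsScalar x) (i : Fin n) :
    x = algebraMap R _ (entry i i x) := by
  refine ext_entry fun k l => ?_
  rw [entry_algebraMap]
  split_ifs with h
  · rw [h]
    exact hx.2 _ _
  · exact hx.1 k l h

theorem IsScalar.commutator_eq_zero {x : upperTriangular n R} (hx : IsScalar x)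
    (c : upperTriangular n R) : x * c - c * x = 0 := by
  refine ext_entry fun k l => ?_
  rw [hx.1.entry_commutator, hx.2 k l, sub_self, zero_mul, map_zero]

/-- A central commutator of upper triangular matrices vanishes. -/
theorem commutator_eq_zero_of_mem_center {x y : upperTriangular n R}
    (h : x * y - y * x ∈ Subalgebra.center R (upperTriangular n R)) : x * y - y * x = 0 := by
  refine ext_entry fun k l => ?_
  rw [map_zero]
  by_cases hkl : k = l
  · subst hkl
    rw [map_sub, entry_mul_self, entry_mul_self, mul_comm, sub_self]
  -- Commuting with the idempotent e_ll kills the off-diagonal entries in column l.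
  · have h1 := entry_commutator_ofDiag (x * y - y * x) (Pi.single l 1) k l
    rw [Subalgebra.mem_center_iff.1 h (ofDiag (Pi.single l 1)), sub_self, map_zero] at h1
    simpa [hkl] using h1.symm

theorem eq_zero_of_add_self_eq_zero (h2 : ∀ r : R, 2 * r = 0 → r = 0) (x : upperTriangular n R)
    (hx : x + x = 0) : x = 0 := by
  refine ext_entry fun k l => ?_
  rw [map_zero]
  refine h2 _ ?_
  rw [two_mul, ← map_add, hx, map_zero]

theorem IsDiagonal.sub {x y : upperTriangular n R} (hx : IsDiagonal x) (hy : IsDiagonal y) :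
    IsDiagonal (x - y) := fun r s h => by rw [map_sub, hx r s h, hy r s h, sub_zero]

theorem IsDiagonal.smul {x : upperTriangular n R} (hx : IsDiagonal x) (c : R) :
    IsDiagonal (c • x) := fun r s h => by rw [map_smul, hx r s h, smul_zero]

theorem isDiagonal_ofDiag (t : Fin n → R) : IsDiagonal (ofDiag t) :=
  fun _ _ h => entry_ofDiag_ne t h

theorem ofDiag_mul_ofDiag (s t : Fin n → R) : ofDiag s * ofDiag t = ofDiag (s * t) :=
  Subtype.ext (Matrix.diagonal_mul_diagonal s t)

/-! ### Structure of commuting traces -/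

section Commuting

variable {q : upperTriangular n R →ₗ[R] upperTriangular n R →ₗ[R] upperTriangular n R}

theorem polarization (h2 : ∀ r : R, 2 * r = 0 → r = 0)
    (hq : ∀ a, q a a * a - a * q a a = 0) (a b : upperTriangular n R) :
    ((q a b + q b a) * a - a * (q a b + q b a)) + (q a a * b - b * q a a) = 0 := by
  have h := eq_zero_of_add_self_eq_zero (n := n) h2
  exact commutator_polarization (R := R) (A := upperTriangular n R) h hq a b

theorem polarization₃ (h2 : ∀ r : R, 2 * r = 0 → r = 0)
    (hq : ∀ a, q a a * a - a * q a a = 0) (a b c : upperTriangular n R) :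
    ((q a b + q b a) * c - c * (q a b + q b a)) + ((q b c + q c b) * a - a * (q b c + q c b))
      + ((q c a + q a c) * b - b * (q c a + q a c)) = 0 := by
  have h := eq_zero_of_add_self_eq_zero (n := n) h2
  exact commutator_polarization₃ (R := R) (A := upperTriangular n R) h hq a b c

theorem isDiagonal_of_commutator_ofDiag {x : upperTriangular n R}
    (h : ∀ t : Fin n → R, x * ofDiag t - ofDiag t * x = 0) : IsDiagonal x := by
  intro r s hrs
  have h1 := entry_commutator_ofDiag x (Pi.single s 1) r s
  rw [h, map_zero] at h1
  simpa [hrs] using h1.symm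

theorem IsScalar.polar_ofDiag
    (hs : ∀ t : Fin n → R, IsScalar (q (ofDiag t) (ofDiag t))) (s t : Fin n → R) (i j : Fin n) :
    entry i i (q (ofDiag s) (ofDiag t) + q (ofDiag t) (ofDiag s))
      = entry j j (q (ofDiag s) (ofDiag t) + q (ofDiag t) (ofDiag s)) := by
  have h := (hs (s + t)).2 i j
  have h1 := (hs s).2 i j
  have h3 := (hs t).2 i j
  simp only [map_add, LinearMap.add_apply] at h ⊢
  linear_combination h - h1 - h3

/-- A commuting trace whose polarization between diagonal matrices and all matrices is scalar
is itself scalar. -/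
theorem isScalar_trace (h2 : ∀ r : R, 2 * r = 0 → r = 0)
    (hq : ∀ a, q a a * a - a * q a a = 0)
    (hB : ∀ t b, IsScalar (q (ofDiag t) b + q b (ofDiag t))) (a : upperTriangular n R) :
    IsScalar (q a a) := by
  have hd : ∀ a, IsDiagonal (q a a) := fun a => isDiagonal_of_commutator_ofDiag fun t => by
    have h := polarization h2 hq a (ofDiag t)
    rwa [add_comm (q a (ofDiag t)), (hB t a).commutator_eq_zero, zero_add] at h
  have hd' : ∀ a b, IsDiagonal (q a b + q b a) := fun a b => by
    have h := ((hd (a + b)).sub (hd a)).sub (hd b)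
    have e : q (a + b) (a + b) - q a a - q b b = q a b + q b a := by
      simp only [map_add, LinearMap.add_apply]
      abel
    rwa [e] at h
  have hlt : ∀ k l : Fin n, k < l → entry k k (q a a) = entry l l (q a a) := by
    intro k l hkl
    set e : upperTriangular n R := unit hkl.le
    have hE : entry k l e = 1 := entry_unit_self hkl.le
    have h0 := congrArg (entry k l) (hq e)
    have h1 := congrArg (entry k l) (polarization h2 hq e a)
    have h3 := congrArg (entry k l) (polarization h2 hq a e)
    rw [(hd e).entry_commutator, hE, map_zero] at h0
    rw [map_add, (hd' e a).entry_commutator, (hd e).entry_commutator, hE, map_zero] at h1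
    rw [map_add, add_comm (q a e), (hd' e a).entry_commutator, (hd a).entry_commutator, hE,
      map_zero] at h3
    -- The diagonal gap of B(e,a) is eliminated between `h3` and `h1`, and that of q(e,e) by `h0`.
    linear_combination h3 - entry k l a * h1 + entry k l a ^ 2 * h0
  refine ⟨hd a, fun i j => ?_⟩
  rcases lt_trichotomy i j with h | rfl | h
  · exact hlt i j h
  · rfl
  · exact (hlt j i h).symm

variable [IsDomain R]

/-- Commuting with t multiplies entry (r,s) by t_s - t_r, a nonzero linear form that cancels even
where t_r = t_s. -/
theorem isDiagonal_trace_ofDiag (h2 : ∀ r : R, 2 * r = 0 → r = 0)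
    (hq : ∀ a, q a a * a - a * q a a = 0) (t : Fin n → R) :
    IsDiagonal (q (ofDiag t) (ofDiag t)) := by
  intro r s hrs
  refine bilin_self_eq_zero_of_mul_eq_zero h2
    (g := (q.compl₁₂ ofDiag ofDiag).compr₂ (entry r s))
    (f := (LinearMap.proj s : (Fin n → R) →ₗ[R] R) - LinearMap.proj r) (y := Pi.single s 1)
    (by simp [hrs]) (fun t => ?_) t
  have := entry_commutator_ofDiag (q (ofDiag t) (ofDiag t)) t r s
  rw [hq, map_zero] at this
  exact this.symm

/-- After subtracting a proper map, a commuting trace is scalar on diagonal matrices. -/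
theorem exists_subProper_isScalar_ofDiag (h2 : ∀ r : R, 2 * r = 0 → r = 0)
    (hq : ∀ a, q a a * a - a * q a a = 0) :
    ∃ (z : R) (μ : upperTriangular n R →ₗ[R] R),
      ∀ t, IsScalar (subProper q z μ (ofDiag t) (ofDiag t)) := by
  have hlt : ∀ i j : Fin n, i < j → ∃ l : (Fin n → R) →ₗ[R] R, ∀ t,
      entry i i (q (ofDiag t) (ofDiag t)) - entry j j (q (ofDiag t) (ofDiag t))
        = (t i - t j) * l t := by
    intro i j hij
    refine ⟨entry i j ∘ₗ (q.flip (unit hij.le) + q (unit hij.le)) ∘ₗ ofDiag, fun t => ?_⟩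
    have h := congrArg (entry i j)
      (polarization h2 hq (ofDiag t) (unit hij.le))
    rw [map_add, entry_commutator_ofDiag,
      (isDiagonal_trace_ofDiag h2 hq t).entry_commutator, entry_unit_self, map_zero] at h
    change _ = (t i - t j) * entry i j (q (ofDiag t) (unit hij.le) + q (unit hij.le) (ofDiag t))
    linear_combination h
  obtain ⟨z, μ, h⟩ := exists_sub_eq_of_dvd
    (p := fun i (t : Fin n → R) => entry i i (q (ofDiag t) (ofDiag t))) (by
      intro i j
      rcases lt_trichotomy i j with hij | rfl | hij
      · exact hlt i j hij
      · exact ⟨0, fun t => by simp⟩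
      · obtain ⟨l, hl⟩ := hlt j i hij
        exact ⟨l, fun t => by linear_combination -hl t⟩)
  refine ⟨z, μ ∘ₗ diag, fun t => ⟨?_, fun i j => ?_⟩⟩
  · rw [subProper_apply, ofDiag_mul_ofDiag]
    exact ((isDiagonal_trace_ofDiag h2 hq t).sub ((isDiagonal_ofDiag _).smul z)).sub
      ((isDiagonal_ofDiag _).smul _)
  · have hd : diag (ofDiag t) = t := funext fun k => entry_ofDiag_self t k
    simp only [subProper_apply, map_sub, map_smul, entry_mul_self, entry_ofDiag_self, smul_eq_mul,
      LinearMap.comp_apply, hd]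
    linear_combination h i j t

/-- Since q(t,t) is scalar, polarization reduces to [B(t,b), t] = 0, which is cancelled as a linear
form in t. -/
theorem isDiagonal_polar_ofDiag (h2 : ∀ r : R, 2 * r = 0 → r = 0)
    (hq : ∀ a, q a a * a - a * q a a = 0)
    (hs : ∀ t, IsScalar (q (ofDiag t) (ofDiag t))) (t : Fin n → R) (b : upperTriangular n R) :
    IsDiagonal (q (ofDiag t) b + q b (ofDiag t)) := by
  intro r s hrs
  refine linearMap_eq_zero_of_mul_eq_zero (g := entry r s ∘ₗ (q.flip b + q b) ∘ₗ ofDiag)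
    (f := (LinearMap.proj s : (Fin n → R) →ₗ[R] R) - LinearMap.proj r) (y := Pi.single s 1)
    (by simp [hrs]) (fun t => ?_) t
  have h := polarization h2 hq (ofDiag t) b
  rw [(hs t).commutator_eq_zero, add_zero] at h
  have h1 := entry_commutator_ofDiag (q (ofDiag t) b + q b (ofDiag t)) t r s
  rw [h, map_zero] at h1
  exact h1.symm

/-- After subtracting a proper map, a commuting trace that is scalar on diagonal matrices has a
scalar polarization between diagonal matrices and all matrices. -/
theorem exists_subProper_isScalar_polar (hn : 2 ≤ n) (h2 : ∀ r : R, 2 * r = 0 → r = 0)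
    (hq : ∀ a, q a a * a - a * q a a = 0)
    (hs : ∀ t, IsScalar (q (ofDiag t) (ofDiag t))) :
    ∃ μ : upperTriangular n R →ₗ[R] R, ∀ t b,
      IsScalar (subProper q 0 μ (ofDiag t) b + subProper q 0 μ b (ofDiag t)) := by
  have hlt : ∀ (b : upperTriangular n R) (k l : Fin n), k < l → ∃ c : R, ∀ t,
      entry k k (q (ofDiag t) b + q b (ofDiag t)) - entry l l (q (ofDiag t) b + q b (ofDiag t))
        = c * (t k - t l) := by
    intro b k l hkl
    set e : upperTriangular n R := unit hkl.le with he
    refine ⟨entry k l (q b e + q e b) - entry k l (q e e) * entry k l b, fun t => ?_⟩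
    have h := congrArg (entry k l)
      (polarization₃ h2 hq (ofDiag t) b e)
    have h' := congrArg (entry k l)
      (polarization h2 hq e (ofDiag t))
    have hE : entry k l e = 1 := entry_unit_self hkl.le
    have hd := isDiagonal_polar_ofDiag h2 hq hs t
    rw [add_comm (q e (ofDiag t)), map_add, map_add, entry_commutator_ofDiag,
      (hd b).entry_commutator, (hd e).entry_commutator, hE, map_zero] at h
    rw [add_comm (q e (ofDiag t)), map_add, entry_commutator_ofDiag,
      (hd e).entry_commutator, hE, map_zero] at h'
    linear_combination h - entry k l b * h'
  set i₀ : Fin n := ⟨0, by omega⟩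
  set i₁ : Fin n := ⟨1, by omega⟩
  have hne : i₀ ≠ i₁ := by simp [i₀, i₁]
  set u : upperTriangular n R := ofDiag (Pi.single i₀ 1) with hu
  set μ : upperTriangular n R →ₗ[R] R := (entry i₀ i₀ - entry i₁ i₁) ∘ₗ (q u + q.flip u) with hμ
  have hμa : ∀ b, μ b = entry i₀ i₀ (q u b + q b u) - entry i₁ i₁ (q u b + q b u) :=
    fun b => rfl
  have hdiff : ∀ b i j t,
      entry i i (q (ofDiag t) b + q b (ofDiag t)) - entry j j (q (ofDiag t) b + q b (ofDiag t))
        = μ b * (t i - t j) := by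
    intro b i j t
    refine sub_eq_of_dvd
      (d := fun i (t : Fin n → R) => entry i i (q (ofDiag t) b + q b (ofDiag t))) ?_ hne i j t
    intro i j
    rcases lt_trichotomy i j with hij | rfl | hij
    · exact hlt b i j hij
    · exact ⟨0, fun t => by simp⟩
    · obtain ⟨c, hc⟩ := hlt b j i hij
      exact ⟨c, fun t => by linear_combination -hc t⟩
  -- Hence subtracting μ changes B(t,b) only by μ(b) t.
  have hμd : ∀ t, μ (ofDiag t) = 0 := fun t => by
    rw [hμa, IsScalar.polar_ofDiag hs _ t i₀ i₁, sub_self]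
  refine ⟨μ, fun t b => ?_⟩
  have hB : subProper q 0 μ (ofDiag t) b + subProper q 0 μ b (ofDiag t)
      = (q (ofDiag t) b + q b (ofDiag t)) - μ b • ofDiag t := by
    simp only [subProper_apply, hμd, zero_smul, sub_zero]
    abel
  rw [hB]
  refine ⟨(isDiagonal_polar_ofDiag h2 hq hs t b).sub ((isDiagonal_ofDiag t).smul _),
    fun i j => ?_⟩
  rw [map_sub, map_sub, map_smul, map_smul, entry_ofDiag_self, entry_ofDiag_self, smul_eq_mul,
    smul_eq_mul]
  linear_combination hdiff b i j t

end Commuting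

end upperTriangular

/-! ### Assembling the proper form -/

open upperTriangular in
theorem corollary3p12 {R : Type*} [CommRing R] [IsDomain R]
    (h2 : ∀ r : R, 2 * r = 0 → r = 0) (n : ℕ) (hn : 2 ≤ n)
    (q : upperTriangular n R →ₗ[R] upperTriangular n R →ₗ[R] upperTriangular n R)
    (hq : IsCentralizing R (bilinTrace q)) :
    IsProperQuadratic R (bilinTrace q) := by
  have hq₀ : ∀ a, q a a * a - a * q a a = 0 := fun a => commutator_eq_zero_of_mem_center (hq a)
  obtain ⟨z, μ₁, hs⟩ := exists_subProper_isScalar_ofDiag h2 hq₀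
  have hq₁ := subProper_commutator hq₀ z μ₁
  obtain ⟨μ₂, hB⟩ := exists_subProper_isScalar_polar hn h2 hq₁ hs
  have hq₂ := subProper_commutator hq₁ 0 μ₂
  have hsc := isScalar_trace h2 hq₂ hB
  let i₀ : Fin n := ⟨0, by omega⟩
  refine ⟨algebraMap R _ z, Algebra.linearMap R _ ∘ₗ (μ₁ + μ₂),
    (subProper (subProper q z μ₁) 0 μ₂).compr₂ (Algebra.linearMap R _ ∘ₗ entry i₀ i₀),
    fun a => ?_⟩
  have h := (hsc a).eq_algebraMap i₀
  change q a a = algebraMap R _ z * a ^ 2 + algebraMap R _ (μ₁ a + μ₂ a) * a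
    + algebraMap R _ (entry i₀ i₀ (subProper (subProper q z μ₁) 0 μ₂ a a))
  rw [← h, subProper_apply, subProper_apply, ← Algebra.smul_def, ← Algebra.smul_def, pow_two,
    add_smul, zero_smul]
  abel
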